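/- **Setting.** Let $M\subseteq\mathbb R^d$ be compact and convex with non-empty interior, let $r\in\mathbb N$, and let $\phi=(\phi[J])_{\emptyset\ne J\subseteq[r]}$ be a filtration function: each $\phi[J]\colon M^r\to[0,\infty)$ is continuous, $\phi[I]\le\phi[J]$ whenever $I\subseteq J$, and each $\phi[J]$ has an essentially bounded gradient (in the weak sense) on the interior of $M^r$. For $x\in M^r$ let $u_1<\dots<u_L$ be the distinct values of $J\mapsto\phi[J](x)$, and let $$\rho(x)=\sup\big\{\epsilon\ge 0:\ \phi[J_1](y)<\dots<\phi[J_L](y)\ \text{ for all } y\in M^r \text{ with } \max_i\|y_i-x_i\|\le\epsilon\big\}\in[0,\infty],$$ where the chain condition is required for all choices of $J_1,\dots,J_L$ such that $J_l$ is minimal with respect to inclusion among the sets $J$ with $\phi[J](x)=u_l$. *Assumption 1.* For some $\alpha\in(0,1]$ and $C<\infty$: $\lambda^{dr}(\{x\in M^r:\rho(x)\le t\})\le Ct^{\alpha}$ for all $t\in[0,1]$. *Assumption 2.* $\mathcal X_t=(X_{t,1},\dots,X_{t,r})=F(\epsilon_t,\epsilon_{t-1},\dots)$, $t\in\mathbb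 Z$, where $(\epsilon_t)_t$ are i.i.d. with values in a measurable space $S$ and $F\colon S^{\mathbb N}\to M^r$ is measurable; $\mathcal X_t$ has a bounded Lebesgue density on $M^r$. For each $t$ let $(\epsilon^{(t)}_s)_s$ be an independent copy of $(\epsilon_s)_s$, and let $\mathcal X^{(m)}_t=F(\epsilon_t,\dots,\epsilon_{t-m+1},\epsilon^{(t)}_{t-m},\epsilon^{(t)}_{t-m-1},\dots)$. There are $p\ge1$ and a summable sequence $(t_m)_m\subset[0,1]$ such that, with the $\alpha$ of Assumption 1, $$\sum_{m=1}^\infty t_m^{-p/\alpha}\,\mathbb E\big[\|X_{0,i}-X^{(m)}_{0,i}\|^p\big]^{1/p}<\infty\qquad(1\le i\le r)$$ (with $0^{-p/\alpha}=\infty$ and $\infty\cdot0=0$). *Feature vectors.* Let $k\ge0$ and $N_k=\binom r{k+1}+\binom r{k+2}$. For $x\in M^r$ let $\mathrm{PD}_k(x)$ be the multiset of points $(b,d)$, $b<d<\infty$, of the $k$-th persistence diagram (simplicial homology with coefficients in a fixed field) of the filtration $s\mapsto\{J:\phi[J](x)\le s\}$. Prepend copies of the trivial feature $(0,0)$ so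 that there are $N_k$ features, and list them as $(b_1,d_1),\dots,(b_{N_k},d_{N_k})$ with $b_1\le\dots\le b_{N_k}$, where non-trivial features with equal births are first listed by increasing death and then reordered by a (possibly random) permutation that depends only on which positions are tied. The feature vector is $(d_1,b_1,\dots,d_{N_k},b_{N_k})\in\mathbb R^{2N_k}$. Let $Z_{k,t}$ and $Z^{(m)}_{k,t}$ be the feature vectors of $\mathcal X_t$ and of $\mathcal X^{(m)}_t$, formed with the same random choice of permutations. **Theorem 1.** Under Assumptions 1 and 2, the process $(Z_{k,t})_t$ is $L^p$-$m$-approximable: $Z_{k,t}$ and $Z^{(m)}_{k,t}$ lie in $L^p$ for all $m$ and $t$, and $$\sum_{m=1}^\infty\mathbb E\big[\|Z_{k,0}-Z^{(m)}_{k,0}\|^p\big]^{1/p}<\infty .$$ -/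

import Mathlib

open MeasureTheory ProbabilityTheory
open scoped ENNReal NNReal

/-- Ordered point clouds of `r` points in Euclidean space of dimension `d`. The norm of this type is
the maximum over the `r` points of the Euclidean norm, so its closed balls are products of closed
Euclidean balls; its canonical measure is Lebesgue measure of dimension `d * r`. -/
abbrev Cloud (d r : ℕ) : Type := Fin r → EuclideanSpace ℝ (Fin d)

/-- The set of clouds all of whose points lie in `M`. -/
def cloudsIn {d : ℕ} (r : ℕ) (M : Set (EuclideanSpace ℝ (Fin d))) : Set (Cloud d r) :=
  {x | ∀ i, x i ∈ M}

section Filtration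

variable {d r : ℕ}

/-- `f` has an essentially bounded (weak) gradient on the open set `U`: there is a measurable
`G` with `‖G‖ ≤ C` almost everywhere on `U` and `∫ f ∂ᵥψ = - ∫ (G v) ψ` for all test functions
`ψ` on `U` and all directions `v`. -/
def HasEssBoundedGradientOn (f : Cloud d r → ℝ) (U : Set (Cloud d r)) : Prop :=
  ∃ (G : Cloud d r → (Cloud d r →L[ℝ] ℝ)) (C : ℝ),
    AEStronglyMeasurable G (volume.restrict U) ∧
    (∀ᵐ x ∂(volume.restrict U), ‖G x‖ ≤ C) ∧
    ∀ ψ : Cloud d r → ℝ, ContDiff ℝ ((⊤ : ℕ∞) : WithTop ℕ∞) ψ → HasCompactSupport ψ → tsupport ψ ⊆ U →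
      ∀ v : Cloud d r, ∫ x, f x * fderiv ℝ ψ x v = - ∫ x, G x v * ψ x

/-- Filtration functions on clouds in `M`: `φ J x` is the time at which the simplex of `x` with
vertex labels `J` appears. The value at `J = ∅` carries no meaning. -/
structure IsFiltrationFunction (M : Set (EuclideanSpace ℝ (Fin d)))
    (φ : Finset (Fin r) → Cloud d r → ℝ) : Prop where
  continuousOn : ∀ J, J.Nonempty → ContinuousOn (φ J) (cloudsIn r M)
  nonneg : ∀ J, J.Nonempty → ∀ x ∈ cloudsIn r M, 0 ≤ φ J x
  mono : ∀ I J, I.Nonempty → I ⊆ J → ∀ x ∈ cloudsIn r M, φ I x ≤ φ J x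
  gradient : ∀ J, J.Nonempty → HasEssBoundedGradientOn (φ J) (interior (cloudsIn r M))

/-- `J` is minimal with respect to inclusion among the simplices that share its filtration time. -/
def IsMinimalAt (φ : Finset (Fin r) → Cloud d r → ℝ) (x : Cloud d r) (J : Finset (Fin r)) : Prop :=
  J.Nonempty ∧ ∀ I, I.Nonempty → I ⊂ J → φ I x ≠ φ J x

/-- If `u₁ < ⋯ < u_L` are the filtration times at `x` and `J₁, …, J_L` are minimal simplices with
`φ J_l x = u_l`, then `φ J₁ y < ⋯ < φ J_L y` for every cloud `y` in `M` with
`‖y i - x i‖ ≤ ε` for all `i`. (A chain is strictly increasing at `y` if and only if all its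
pairs are strictly increasing at `y`.) -/
def ChainStable (M : Set (EuclideanSpace ℝ (Fin d))) (φ : Finset (Fin r) → Cloud d r → ℝ)
    (x : Cloud d r) (ε : ℝ) : Prop :=
  ∀ y ∈ cloudsIn r M, (∀ i, ‖y i - x i‖ ≤ ε) →
    ∀ I J, IsMinimalAt φ x I → IsMinimalAt φ x J → φ I x < φ J x → φ I y < φ J y

/-- The stability radius of the filtration at `x`; it is `∞` when no perturbation inside `M`
changes the chain. -/
noncomputable def stabilityRadius (M : Set (EuclideanSpace ℝ (Fin d)))
    (φ : Finset (Fin r) → Cloud d r → ℝ) (x : Cloud d r) : ℝ≥0∞ :=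
  sSup {e | ∃ ε : ℝ, 0 ≤ ε ∧ ChainStable M φ x ε ∧ e = ENNReal.ofReal ε}

/-- The Lebesgue measure of the sublevel set `{ρ ≤ t}` is at most `C t ^ α` for `t ∈ [0,1]`. -/
def StabilityExponent (M : Set (EuclideanSpace ℝ (Fin d)))
    (φ : Finset (Fin r) → Cloud d r → ℝ) (α : ℝ) : Prop :=
  ∃ C : ℝ, 0 ≤ C ∧ ∀ t : ℝ, 0 ≤ t → t ≤ 1 →
    volume {x ∈ cloudsIn r M | stabilityRadius M φ x ≤ ENNReal.ofReal t}
      ≤ ENNReal.ofReal (C * t ^ α)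

end Filtration

section Persistence

variable {d r : ℕ} (𝕂 : Type*) [Field 𝕂]

/-- The simplicial boundary operator on chains of finite vertex sets,
`∂ e_J = ∑ j ∈ J, (-1) ^ #{i ∈ J | i < j} e_{J \ {j}}`, with boundary `0` for single vertices. -/
noncomputable def bdry : (Finset (Fin r) → 𝕂) →ₗ[𝕂] (Finset (Fin r) → 𝕂) where
  toFun c I := if I.Nonempty then
      ∑ j ∈ Iᶜ, (-1 : 𝕂) ^ (I.filter (fun i => i < j)).card * c (insert j I) else 0
  map_add' c c' := by
    funext I
    by_cases h : I.Nonempty <;> simp [h, mul_add, Finset.sum_add_distrib]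
  map_smul' a c := by
    funext I
    by_cases h : I.Nonempty <;> simp [h, Finset.mul_sum, mul_left_comm]

/-- Chains of dimension `n` on the simplices of `K`. -/
def chainsOn (K : Set (Finset (Fin r))) (n : ℕ) : Submodule 𝕂 (Finset (Fin r) → 𝕂) where
  carrier := {c | ∀ J, ¬ (J ∈ K ∧ J.card = n + 1) → c J = 0}
  zero_mem' := fun _ _ => rfl
  add_mem' := fun ha hb J hJ => by simp [ha J hJ, hb J hJ]
  smul_mem' := fun a _ hc J hJ => by simp [hc J hJ]

/-- Cycles of dimension `n` on `K`. -/
noncomputable def cyclesOn (K : Set (Finset (Fin r))) (n : ℕ) :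
    Submodule 𝕂 (Finset (Fin r) → 𝕂) :=
  chainsOn 𝕂 K n ⊓ LinearMap.ker (bdry 𝕂)

/-- Boundaries of dimension `n` on `K`. -/
noncomputable def boundariesOn (K : Set (Finset (Fin r))) (n : ℕ) :
    Submodule 𝕂 (Finset (Fin r) → 𝕂) :=
  (chainsOn 𝕂 K (n + 1)).map (bdry 𝕂)

/-- The persistent Betti number of `K ⊆ K'`: the dimension of the persistent homology group
`Z_n(K) / (Z_n(K) ∩ B_n(K'))`, the image of `H_n(K) → H_n(K')`. -/
noncomputable def persistentBetti (n : ℕ) (K K' : Set (Finset (Fin r))) : ℕ :=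
  Module.finrank 𝕂
    (cyclesOn 𝕂 K n ⧸ (boundariesOn 𝕂 K' n).comap (cyclesOn 𝕂 K n).subtype)

/-- The complex of the filtration of `x` at time `s`. -/
def complexLE (φ : Finset (Fin r) → Cloud d r → ℝ) (x : Cloud d r) (s : ℝ) :
    Set (Finset (Fin r)) := {J | J.Nonempty ∧ φ J x ≤ s}

/-- The complex of the filtration of `x` immediately before time `s`. -/
def complexLT (φ : Finset (Fin r) → Cloud d r → ℝ) (x : Cloud d r) (s : ℝ) :
    Set (Finset (Fin r)) := {J | J.Nonempty ∧ φ J x < s}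

/-- The multiplicity of the point `(b, e)`, `b < e`, in the persistence diagram of dimension `k`:
the number of classes born at time `b` that die at time `e`. -/
noncomputable def featureMultiplicity (φ : Finset (Fin r) → Cloud d r → ℝ) (k : ℕ) (x : Cloud d r)
    (b e : ℝ) : ℤ :=
  ((persistentBetti 𝕂 k (complexLE φ x b) (complexLT φ x e) : ℤ)
      - persistentBetti 𝕂 k (complexLT φ x b) (complexLT φ x e))
    - ((persistentBetti 𝕂 k (complexLE φ x b) (complexLE φ x e) : ℤ)
      - persistentBetti 𝕂 k (complexLT φ x b) (complexLE φ x e))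

/-- The values taken by the filtration function at `x`. -/
noncomputable def filtrationTimes (φ : Finset (Fin r) → Cloud d r → ℝ) (x : Cloud d r) :
    Finset ℝ :=
  (Finset.univ.filter (fun J : Finset (Fin r) => J.Nonempty)).image (fun J => φ J x)

/-- The persistence diagram of dimension `k` of the cloud `x`, as the multiset of its points
`(b, e)` with `b < e < ∞`. -/
noncomputable def persistenceDiagram (φ : Finset (Fin r) → Cloud d r → ℝ) (k : ℕ)
    (x : Cloud d r) : Multiset (ℝ × ℝ) :=
  ∑ q ∈ (filtrationTimes φ x ×ˢ filtrationTimes φ x).filter (fun q => q.1 < q.2),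
    Multiset.replicate (featureMultiplicity 𝕂 φ k x q.1 q.2).toNat q

/-- The number of features listed in a feature vector. -/
def numFeatures (r k : ℕ) : ℕ := r.choose (k + 1) + r.choose (k + 2)

/-- The points of the diagram, ascending in the birth time and, for equal births, in the death
time, preceded by as many copies of the trivial feature `(0, 0)` as are needed to reach
`numFeatures r k` features. -/
noncomputable def sortedFeatures (φ : Finset (Fin r) → Cloud d r → ℝ) (k : ℕ) (x : Cloud d r)
    (i : Fin (numFeatures r k)) : ℝ × ℝ :=
  (List.replicate (numFeatures r k - (persistenceDiagram 𝕂 φ k x).card) ((0 : ℝ), (0 : ℝ)) ++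
    ((((persistenceDiagram 𝕂 φ k x).map toLex).sort (· ≤ ·)).map ofLex)).getD i (0, 0)

/-- A tie-breaking rule for lists of `N` entries: for each partition of the positions into groups
of tied entries, a permutation of the positions that respects the groups. -/
def IsTieRule {N : ℕ} (τ : Setoid (Fin N) → Equiv.Perm (Fin N)) : Prop :=
  ∀ (s : Setoid (Fin N)) (i : Fin N), s.r (τ s i) i

/-- Two positions are tied if they carry features with the same birth time, both trivial or both
non-trivial. -/
noncomputable def birthTies (φ : Finset (Fin r) → Cloud d r → ℝ) (k : ℕ) (x : Cloud d r) :
    Setoid (Fin (numFeatures r k)) :=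
  Setoid.ker (fun i => ((sortedFeatures 𝕂 φ k x i).1,
    (sortedFeatures 𝕂 φ k x i).1 < (sortedFeatures 𝕂 φ k x i).2))

/-- The feature vector `(d₁, b₁, …, d_N, b_N)` of the cloud `x` in dimension `k`, where
`b₁ ≤ ⋯ ≤ b_N` and features with the same birth are ordered by the rule `τ`. The entry with second
index `0` is a death, the entry with second index `1` a birth. -/
noncomputable def featureVector (φ : Finset (Fin r) → Cloud d r → ℝ) (k : ℕ)
    (τ : Setoid (Fin (numFeatures r k)) → Equiv.Perm (Fin (numFeatures r k)))
    (x : Cloud d r) : EuclideanSpace ℝ (Fin (numFeatures r k) × Fin 2) :=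
  WithLp.toLp 2 (fun q =>
    if q.2 = 0 then (sortedFeatures 𝕂 φ k x (τ (birthTies 𝕂 φ k x) q.1)).2
    else (sortedFeatures 𝕂 φ k x (τ (birthTies 𝕂 φ k x) q.1)).1)

end Persistence

section TimeSeries

variable {Ω S : Type*} {d r : ℕ}

/-- The Bernoulli shift `X_t = F(ε_t, ε_{t-1}, …)`. -/
def shiftCloud (F : (ℕ → S) → Cloud d r) (ε : ℤ → Ω → S) (t : ℤ) (ω : Ω) : Cloud d r :=
  F (fun j => ε (t - j) ω)

/-- The coupled process `X_t^{(m)} = F(ε_t, …, ε_{t-m+1}, ε_{t-m}^{(t)}, ε_{t-m-1}^{(t)}, …)`;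
`ε' t s` stands for `ε_s^{(t)}`. -/
def coupledCloud (F : (ℕ → S) → Cloud d r) (ε : ℤ → Ω → S) (ε' : ℤ → ℤ → Ω → S) (m : ℕ) (t : ℤ)
    (ω : Ω) : Cloud d r :=
  F (fun j => if j < m then ε (t - j) ω else ε' t (t - j) ω)

/-- The random cloud `X` has a bounded Lebesgue density on the clouds in `M`. -/
def HasBoundedDensityOn [MeasurableSpace Ω] (M : Set (EuclideanSpace ℝ (Fin d)))
    (P : Measure Ω) (X : Ω → Cloud d r) : Prop :=
  ∃ (f : Cloud d r → ℝ≥0∞) (C : ℝ≥0), Measurable f ∧ (∀ x, f x ≤ C) ∧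
    P.map X = (volume.restrict (cloudsIn r M)).withDensity f

end TimeSeries

/-! Persistent homology sees a filtration only through the order in which simplices appear. If two
clouds order their simplices alike, their persistence diagrams correspond under a change of
filtration times. Each entry of the two feature vectors is then either zero for both clouds or the
filtration time of one common simplex (`exists_featureVector_entry`). Filtration functions are
Lipschitz: mollifying turns the weak gradient bound into a classical one, and convexity lets the
mean value inequality act along segments (`IsFiltrationFunction.exists_lipschitz`). Hence feature
vectors are Lipschitz along pairs of clouds with the same order, and bounded in any case.

Two clouds within distance `t` have the same order as soon as both stability radii exceed `t`
(`sameOrder_of_dist_le`). Both radii matter: that of `x` keeps strict inequalities strict at `y`,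
and that of `y` prevents ties at `x` from splitting.

Apply this to `X` and its coupled version `Y`. If they are more than `t` apart, the bounded
difference is absorbed by `t⁻¹ * ‖X - Y‖`. If one of them has stability radius at most `t`, the
bounded density and the stability exponent give an event of probability of order `t ^ α`; `Y` is
covered because it has the law of `X` (`identDistrib_coupled_innovations`). With `t = w ^ (p / α)`
the first contribution carries exactly the weight of the approximability condition, and the second
has `L^p` norm of order `w`. Both are summable. -/

/-! ### Stability radius and the order of simplices. -/

section Order

variable {d r : ℕ}

/-- The filtration functions at `x` and at `y` order the simplices in the same way. -/
def SameOrder (φ : Finset (Fin r) → Cloud d r → ℝ) (x y : Cloud d r) : Prop :=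
  ∀ I J : Finset (Fin r), I.Nonempty → J.Nonempty → (φ I x ≤ φ J x ↔ φ I y ≤ φ J y)

variable {M : Set (EuclideanSpace ℝ (Fin d))} {φ : Finset (Fin r) → Cloud d r → ℝ}
  {x y : Cloud d r}

/-- Every simplex contains a minimal simplex with the same filtration time. -/
lemma exists_isMinimalAt_subset (φ : Finset (Fin r) → Cloud d r → ℝ) (x : Cloud d r)
    (J : Finset (Fin r)) (hJ : J.Nonempty) :
    ∃ I ⊆ J, IsMinimalAt φ x I ∧ φ I x = φ J x := by
  induction J using Finset.strongInduction with
  | H J ih =>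
    by_cases h : IsMinimalAt φ x J
    · exact ⟨J, subset_rfl, h, rfl⟩
    · simp only [IsMinimalAt, not_and, not_forall, not_not] at h
      obtain ⟨I, hI, hIJ, he⟩ := h hJ
      obtain ⟨I', h1, h2, h3⟩ := ih I hIJ hI
      exact ⟨I', h1.trans hIJ.subset, h2, h3.trans he⟩

/-- The transfer of minimality from `x` to `y`, given that it is known in both directions for
smaller simplices. -/
lemma IsMinimalAt.of_chain (hmono : ∀ I J, I.Nonempty → I ⊆ J → φ I x ≤ φ J x)
    (hxy : ∀ I J, IsMinimalAt φ x I → IsMinimalAt φ x J → φ I x < φ J x → φ I y < φ J y)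
    {J : Finset (Fin r)} (ih : ∀ I ⊂ J, (IsMinimalAt φ x I ↔ IsMinimalAt φ y I))
    (hJ : IsMinimalAt φ x J) : IsMinimalAt φ y J := by
  refine ⟨hJ.1, fun I hI hIJ he => ?_⟩
  obtain ⟨I', h1, h2, h3⟩ := exists_isMinimalAt_subset φ y I hI
  have hI'J : I' ⊂ J := lt_of_le_of_lt h1 hIJ
  have hx' := (ih I' hI'J).2 h2
  -- A proper subset tied with `J` at `y` would be strictly earlier at `x`, since `J` is minimal
  -- there, and the chain carries this strict inequality to `y`.
  have := hxy I' J hx' hJ (lt_of_le_of_ne (hmono _ _ h2.1 hI'J.subset) (hJ.2 I' h2.1 hI'J))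
  rw [h3, he] at this
  exact lt_irrefl _ this

/-- Testing minimality involves only proper subsets, so induction along inclusion transfers it in
both directions at once. -/
lemma isMinimalAt_iff_of_chain (hmx : ∀ I J, I.Nonempty → I ⊆ J → φ I x ≤ φ J x)
    (hmy : ∀ I J, I.Nonempty → I ⊆ J → φ I y ≤ φ J y)
    (hxy : ∀ I J, IsMinimalAt φ x I → IsMinimalAt φ x J → φ I x < φ J x → φ I y < φ J y)
    (hyx : ∀ I J, IsMinimalAt φ y I → IsMinimalAt φ y J → φ I y < φ J y → φ I x < φ J x)
    (J : Finset (Fin r)) : IsMinimalAt φ x J ↔ IsMinimalAt φ y J := by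
  induction J using Finset.strongInduction with
  | H J ih =>
    exact ⟨IsMinimalAt.of_chain hmx hxy ih,
      IsMinimalAt.of_chain hmy hyx fun I hI => (ih I hI).symm⟩

/-- If the strict order of the minimal simplices at either cloud persists at the other one, then all
simplices are ordered in the same way. -/
lemma sameOrder_of_chain (hmx : ∀ I J, I.Nonempty → I ⊆ J → φ I x ≤ φ J x)
    (hmy : ∀ I J, I.Nonempty → I ⊆ J → φ I y ≤ φ J y)
    (hxy : ∀ I J, IsMinimalAt φ x I → IsMinimalAt φ x J → φ I x < φ J x → φ I y < φ J y)
    (hyx : ∀ I J, IsMinimalAt φ y I → IsMinimalAt φ y J → φ I y < φ J y → φ I x < φ J x) :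
    SameOrder φ x y := by
  have hmin := isMinimalAt_iff_of_chain hmx hmy hxy hyx
  have rep : ∀ J : Finset (Fin r), J.Nonempty → ∃ I, IsMinimalAt φ x I ∧ φ I x = φ J x ∧
      φ I y = φ J y := by
    intro J hJ
    obtain ⟨I, hIJ, hI, he⟩ := exists_isMinimalAt_subset φ x J hJ
    obtain ⟨I', hIJ', hI', he'⟩ := exists_isMinimalAt_subset φ y J hJ
    -- The representative `I` found at `x` must also be tied with `J` at `y`. Otherwise the
    -- representative `I'` found at `y` comes strictly later than `I` there, hence also at `x`,
    -- although `I' ⊆ J` and `J` is tied with `I` at `x`.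
    refine ⟨I, hI, he, le_antisymm (hmy _ _ hI.1 hIJ) (not_lt.1 fun hlt => ?_)⟩
    rw [← he'] at hlt
    have := hyx I I' ((hmin I).1 hI) hI' hlt
    rw [he] at this
    exact absurd (hmx I' J hI'.1 hIJ') (not_le.2 this)
  intro I J hI hJ
  obtain ⟨I', hI', ex, ey⟩ := rep I hI
  obtain ⟨J', hJ', fx, fy⟩ := rep J hJ
  rw [← ex, ← fx, ← ey, ← fy, ← not_lt, ← not_lt, not_iff_not]
  exact ⟨hxy J' I' hJ' hI', hyx J' I' ((hmin _).1 hJ') ((hmin _).1 hI')⟩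

/-- Clouds that are closer to each other than their stability radii have the same order of
simplices. -/
lemma sameOrder_of_dist_le (hφ : IsFiltrationFunction M φ) (hx : x ∈ cloudsIn r M)
    (hy : y ∈ cloudsIn r M) {t : ℝ} (hxt : ENNReal.ofReal t < stabilityRadius M φ x)
    (hyt : ENNReal.ofReal t < stabilityRadius M φ y) (hd : ‖x - y‖ ≤ t) : SameOrder φ x y := by
  have key : ∀ x y : Cloud d r, y ∈ cloudsIn r M → ENNReal.ofReal t < stabilityRadius M φ x →
      ‖x - y‖ ≤ t → ∀ I J, IsMinimalAt φ x I → IsMinimalAt φ x J → φ I x < φ J x →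
        φ I y < φ J y := by
    intro x y hy hxt hd
    obtain ⟨e, ⟨ε, -, hc, rfl⟩, he⟩ := lt_sSup_iff.1 hxt
    have htε : t < ε := (ENNReal.ofReal_lt_ofReal_iff_of_nonneg ((norm_nonneg _).trans hd)).1 he
    refine hc y hy fun i => ?_
    rw [norm_sub_rev]
    exact (norm_le_pi_norm (x - y) i).trans (hd.trans htε.le)
  exact sameOrder_of_chain (fun I J hI h => hφ.mono I J hI h x hx)
    (fun I J hI h => hφ.mono I J hI h y hy) (key x y hy hxt hd)
    (key y x hx hyt (by rwa [norm_sub_rev]))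

end Order

/-! ### Invariance of diagrams and feature positions under a change of times. -/

section Transfer

variable {d r : ℕ} (𝕂 : Type*) [Field 𝕂] {φ : Finset (Fin r) → Cloud d r → ℝ} {x y : Cloud d r}

lemma SameOrder.lt_iff (h : SameOrder φ x y) {I J : Finset (Fin r)} (hI : I.Nonempty)
    (hJ : J.Nonempty) : φ I x < φ J x ↔ φ I y < φ J y := by
  rw [← not_le, ← not_le, h J I hJ hI]

lemma SameOrder.eq_iff (h : SameOrder φ x y) {I J : Finset (Fin r)} (hI : I.Nonempty)
    (hJ : J.Nonempty) : φ I x = φ J x ↔ φ I y = φ J y := by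
  rw [le_antisymm_iff, le_antisymm_iff, h I J hI hJ, h J I hJ hI]

/-- The change of filtration times between clouds with the same order of simplices. -/
lemma SameOrder.exists_timeChange (h : SameOrder φ x y) :
    ∃ g : ℝ → ℝ, ∀ I : Finset (Fin r), I.Nonempty → g (φ I x) = φ I y := by
  classical
  -- The choice of simplex is immaterial because ties are preserved; the default 0 is never read at
  -- a filtration time.
  refine ⟨fun s => if hs : ∃ I : Finset (Fin r), I.Nonempty ∧ φ I x = s then φ hs.choose y else 0,
    fun I hI => ?_⟩
  have hs : ∃ J : Finset (Fin r), J.Nonempty ∧ φ J x = φ I x := ⟨I, hI, rfl⟩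
  simp only [dif_pos hs]
  exact (h.eq_iff hs.choose_spec.1 hI).1 hs.choose_spec.2

lemma mem_filtrationTimes {s : ℝ} :
    s ∈ filtrationTimes φ x ↔ ∃ I : Finset (Fin r), I.Nonempty ∧ φ I x = s := by
  simp [filtrationTimes]

lemma SameOrder.complexLE_eq (h : SameOrder φ x y) {I : Finset (Fin r)} (hI : I.Nonempty) :
    complexLE φ x (φ I x) = complexLE φ y (φ I y) := by
  ext J
  exact and_congr_right fun hJ => h J I hJ hI

lemma SameOrder.complexLT_eq (h : SameOrder φ x y) {I : Finset (Fin r)} (hI : I.Nonempty) :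
    complexLT φ x (φ I x) = complexLT φ y (φ I y) := by
  ext J
  exact and_congr_right fun hJ => h.lt_iff hJ hI

lemma SameOrder.featureMultiplicity_eq (h : SameOrder φ x y) (k : ℕ) {I J : Finset (Fin r)}
    (hI : I.Nonempty) (hJ : J.Nonempty) :
    featureMultiplicity 𝕂 φ k x (φ I x) (φ J x) = featureMultiplicity 𝕂 φ k y (φ I y) (φ J y) := by
  simp only [featureMultiplicity, h.complexLE_eq hI, h.complexLE_eq hJ, h.complexLT_eq hI,
    h.complexLT_eq hJ]

lemma exists_of_mem_persistenceDiagram {k : ℕ} {q : ℝ × ℝ}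
    (hq : q ∈ persistenceDiagram 𝕂 φ k x) :
    ∃ I J : Finset (Fin r), I.Nonempty ∧ J.Nonempty ∧ q = (φ I x, φ J x) ∧ φ I x < φ J x := by
  obtain ⟨q', hq', h⟩ := Multiset.mem_sum.1 hq
  obtain rfl := Multiset.eq_of_mem_replicate h
  rw [Finset.mem_filter, Finset.mem_product, mem_filtrationTimes, mem_filtrationTimes] at hq'
  obtain ⟨⟨⟨I, hI, h1⟩, ⟨J, hJ, h2⟩⟩, hlt⟩ := hq'
  exact ⟨I, J, hI, hJ, by rw [h1, h2], by rwa [h1, h2]⟩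

/-- Multiplicities depend only on the complexes at and just before two filtration times, and these
coincide for both clouds. The time change is injective on filtration times, so no diagram points
merge. -/
lemma SameOrder.persistenceDiagram_eq (h : SameOrder φ x y) (k : ℕ) {g : ℝ → ℝ}
    (hg : ∀ I : Finset (Fin r), I.Nonempty → g (φ I x) = φ I y) :
    persistenceDiagram 𝕂 φ k y = (persistenceDiagram 𝕂 φ k x).map (Prod.map g g) := by
  unfold persistenceDiagram
  rw [← Multiset.coe_mapAddMonoidHom, map_sum]
  symm
  refine Finset.sum_bij (fun q _ => Prod.map g g q) ?_ ?_ ?_ ?_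
  · rintro ⟨b, e⟩ hq
    simp only [Finset.mem_filter, Finset.mem_product, mem_filtrationTimes] at hq ⊢
    obtain ⟨⟨⟨I, hI, rfl⟩, ⟨J, hJ, rfl⟩⟩, hlt⟩ := hq
    simp only [Prod.map, hg I hI, hg J hJ]
    exact ⟨⟨⟨I, hI, rfl⟩, ⟨J, hJ, rfl⟩⟩, (h.lt_iff hI hJ).1 hlt⟩
  · rintro ⟨b, e⟩ hq ⟨b', e'⟩ hq' he
    simp only [Finset.mem_filter, Finset.mem_product, mem_filtrationTimes] at hq hq'
    obtain ⟨⟨⟨I, hI, rfl⟩, ⟨J, hJ, rfl⟩⟩, -⟩ := hq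
    obtain ⟨⟨⟨I', hI', rfl⟩, ⟨J', hJ', rfl⟩⟩, -⟩ := hq'
    simp only [Prod.map, hg I hI, hg J hJ, hg I' hI', hg J' hJ', Prod.mk.injEq] at he ⊢
    exact ⟨(h.eq_iff hI hI').2 he.1, (h.eq_iff hJ hJ').2 he.2⟩
  · rintro ⟨b, e⟩ hq
    simp only [Finset.mem_filter, Finset.mem_product, mem_filtrationTimes] at hq
    obtain ⟨⟨⟨I, hI, rfl⟩, ⟨J, hJ, rfl⟩⟩, hlt⟩ := hq
    refine ⟨(φ I x, φ J x), ?_, by simp [hg I hI, hg J hJ]⟩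
    simp only [Finset.mem_filter, Finset.mem_product, mem_filtrationTimes]
    exact ⟨⟨⟨I, hI, rfl⟩, ⟨J, hJ, rfl⟩⟩, (h.lt_iff hI hJ).2 hlt⟩
  · rintro ⟨b, e⟩ hq
    simp only [Finset.mem_filter, Finset.mem_product, mem_filtrationTimes] at hq
    obtain ⟨⟨⟨I, hI, rfl⟩, ⟨J, hJ, rfl⟩⟩, -⟩ := hq
    simp only [Multiset.coe_mapAddMonoidHom, Multiset.map_replicate, Prod.map, hg I hI, hg J hJ,
      h.featureMultiplicity_eq 𝕂 k hI hJ]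

/-- The sorted list of the points of the diagram. -/
noncomputable def sortedDiagram (φ : Finset (Fin r) → Cloud d r → ℝ) (k : ℕ) (x : Cloud d r) :
    List (ℝ × ℝ) :=
  (((persistenceDiagram 𝕂 φ k x).map toLex).sort (· ≤ ·)).map ofLex

lemma mem_sortedDiagram {k : ℕ} {q : ℝ × ℝ} :
    q ∈ sortedDiagram 𝕂 φ k x ↔ q ∈ persistenceDiagram 𝕂 φ k x := by
  unfold sortedDiagram
  rw [List.mem_map]
  constructor
  · rintro ⟨a, ha, rfl⟩
    obtain ⟨q, hq, rfl⟩ := Multiset.mem_map.1 ((Multiset.mem_sort _).1 ha)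
    exact hq
  · exact fun h => ⟨toLex q, (Multiset.mem_sort _).2 (Multiset.mem_map_of_mem _ h), rfl⟩

/-- Sorting commutes with the time change because the latter preserves the lexicographic order on
the points of the diagram; off the filtration times it need not be monotone. -/
lemma SameOrder.sortedDiagram_eq (h : SameOrder φ x y) (k : ℕ) {g : ℝ → ℝ}
    (hg : ∀ I : Finset (Fin r), I.Nonempty → g (φ I x) = φ I y) :
    sortedDiagram 𝕂 φ k y = (sortedDiagram 𝕂 φ k x).map (Prod.map g g) := by
  unfold sortedDiagram
  rw [h.persistenceDiagram_eq 𝕂 k hg, Multiset.map_map, List.map_map]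
  have key := Multiset.map_sort (s := (persistenceDiagram 𝕂 φ k x).map toLex) (r := (· ≤ ·))
    (r' := (· ≤ ·)) (f := fun q => toLex (Prod.map g g (ofLex q))) ?_
  · rw [Multiset.map_map] at key
    have e : (⇑toLex ∘ Prod.map g g : ℝ × ℝ → ℝ ×ₗ ℝ) =
        (fun q => toLex (Prod.map g g (ofLex q))) ∘ toLex := by ext1 q; simp
    rw [e, ← key, List.map_map]
    rfl
  · intro a ha b hb
    obtain ⟨a', ha', rfl⟩ := Multiset.mem_map.1 ha
    obtain ⟨b', hb', rfl⟩ := Multiset.mem_map.1 hb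
    obtain ⟨I, J, hI, hJ, rfl, -⟩ := exists_of_mem_persistenceDiagram 𝕂 ha'
    obtain ⟨I', J', hI', hJ', rfl, -⟩ := exists_of_mem_persistenceDiagram 𝕂 hb'
    simp only [ofLex_toLex, Prod.map, hg I hI, hg J hJ, hg I' hI', hg J' hJ', Prod.Lex.le_iff]
    rw [h.lt_iff hI hI', h.eq_iff hI hI', h J J' hJ hJ']

/-- The feature selected by a pair of simplices, or the trivial feature. -/
def selectedFeature (φ : Finset (Fin r) → Cloud d r → ℝ)
    (c : Option (Finset (Fin r) × Finset (Fin r))) (x : Cloud d r) : ℝ × ℝ :=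
  c.elim (0, 0) fun p => (φ p.1 x, φ p.2 x)

lemma sortedFeatures_eq (k : ℕ) (i : Fin (numFeatures r k)) :
    sortedFeatures 𝕂 φ k x i =
      (List.replicate (numFeatures r k - (sortedDiagram 𝕂 φ k x).length) ((0 : ℝ), (0 : ℝ)) ++
        sortedDiagram 𝕂 φ k x).getD i (0, 0) := by
  simp [sortedFeatures, sortedDiagram]

/-- Reading past the end returns the same `(0, 0)` as the padding, so no bound on the number of
diagram points is needed. -/
lemma mem_or_eq_zero_of_getD (n i : ℕ) (l : List (ℝ × ℝ)) (f : ℝ × ℝ → ℝ × ℝ) :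
    ((List.replicate n ((0 : ℝ), (0 : ℝ)) ++ l).getD i (0, 0) = (0, 0) ∧
      (List.replicate n ((0 : ℝ), (0 : ℝ)) ++ l.map f).getD i (0, 0) = (0, 0)) ∨
    ∃ q ∈ l, (List.replicate n ((0 : ℝ), (0 : ℝ)) ++ l).getD i (0, 0) = q ∧
      (List.replicate n ((0 : ℝ), (0 : ℝ)) ++ l.map f).getD i (0, 0) = f q := by
  rcases lt_or_ge i n with hi | hi
  · left
    simp [List.getD_eq_getElem?_getD, List.getElem?_append, hi]
  · simp only [List.getD_eq_getElem?_getD, List.getElem?_append, List.length_replicate,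
      not_lt.2 hi, if_false]
    rcases lt_or_ge (i - n) l.length with h | h
    · right
      exact ⟨l[i - n], List.getElem_mem h, by simp [h], by simp [h]⟩
    · left
      simp [h]

/-- Clouds with the same order of simplices read off their features from the same simplices. -/
lemma exists_selection (k : ℕ) (x : Cloud d r) (i : Fin (numFeatures r k)) :
    ∃ c : Option (Finset (Fin r) × Finset (Fin r)),
      (∀ p ∈ c, p.1.Nonempty ∧ p.2.Nonempty ∧ φ p.1 x < φ p.2 x) ∧
      ∀ y, SameOrder φ x y → sortedFeatures 𝕂 φ k y i = selectedFeature φ c y := by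
  set l := sortedDiagram 𝕂 φ k x with hl
  have hget : ∀ y, SameOrder φ x y → ∀ g : ℝ → ℝ,
      (∀ I : Finset (Fin r), I.Nonempty → g (φ I x) = φ I y) →
      sortedFeatures 𝕂 φ k y i = (List.replicate (numFeatures r k - l.length) ((0 : ℝ), (0 : ℝ)) ++
        l.map (Prod.map g g)).getD i (0, 0) := by
    intro y hy g hg
    rw [sortedFeatures_eq, hy.sortedDiagram_eq 𝕂 k hg, List.length_map]
  rcases mem_or_eq_zero_of_getD (numFeatures r k - l.length) i l id with h | ⟨q, hq, h, -⟩
  -- Diagram points satisfy `b < e`, so `(0, 0)` is never one of them. A position therefore cannot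
  -- be padding for one cloud and a diagram point for the other.
  · by_cases hz : ((0 : ℝ), (0 : ℝ)) ∈ l
    · obtain ⟨I, J, hI, hJ, he, hlt⟩ :=
        exists_of_mem_persistenceDiagram 𝕂 ((mem_sortedDiagram 𝕂).1 hz)
      rw [Prod.mk.injEq] at he
      rw [← he.1, ← he.2] at hlt
      exact absurd hlt (lt_irrefl _)
    · refine ⟨none, by simp, fun y hy => ?_⟩
      obtain ⟨g, hg⟩ := hy.exists_timeChange
      rw [hget y hy g hg]
      rcases mem_or_eq_zero_of_getD (numFeatures r k - l.length) i l (Prod.map g g) with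
        h' | ⟨q, hq, h', -⟩
      · exact h'.2
      · rw [h.1] at h'
        exact absurd (h' ▸ hq) hz
  · obtain ⟨I, J, hI, hJ, rfl, hlt⟩ :=
      exists_of_mem_persistenceDiagram 𝕂 ((mem_sortedDiagram 𝕂).1 hq)
    refine ⟨some (I, J), by simpa using ⟨hI, hJ, hlt⟩, fun y hy => ?_⟩
    obtain ⟨g, hg⟩ := hy.exists_timeChange
    rw [hget y hy g hg]
    rcases mem_or_eq_zero_of_getD (numFeatures r k - l.length) i l (Prod.map g g) with
      h' | ⟨q, -, h', h''⟩
    · rw [h] at h'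
      have := h'.1
      rw [Prod.mk.injEq] at this
      rw [this.1, this.2] at hlt
      exact absurd hlt (lt_irrefl _)
    · rw [h] at h'
      rw [h'', ← h']
      simp [selectedFeature, hg I hI, hg J hJ]

/-- The flag `b < e` is essential: a non-trivial feature born at time 0 for `x` may be born later
for `y`, so its tie with the padding in birth time alone would not be invariant. -/
lemma SameOrder.birthTies_eq (h : SameOrder φ x y) (k : ℕ) :
    birthTies 𝕂 φ k x = birthTies 𝕂 φ k y := by
  have hx : SameOrder φ x x := fun _ _ _ _ => Iff.rfl
  ext i j
  obtain ⟨c, hc, hcy⟩ := exists_selection 𝕂 (φ := φ) k x i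
  obtain ⟨c', hc', hcy'⟩ := exists_selection 𝕂 (φ := φ) k x j
  change (_, _) = (_, _) ↔ (_, _) = (_, _)
  simp only [hcy x hx, hcy y h, hcy' x hx, hcy' y h, Prod.mk.injEq]
  rcases c with _ | ⟨I, J⟩ <;> rcases c' with _ | ⟨I', J'⟩
  · simp [selectedFeature]
  · obtain ⟨h1, h2, h3⟩ := hc' _ rfl
    simp [selectedFeature, h3, (h.lt_iff h1 h2).1 h3]
  · obtain ⟨h1, h2, h3⟩ := hc _ rfl
    simp [selectedFeature, h3, (h.lt_iff h1 h2).1 h3]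
  · obtain ⟨h1, h2, h3⟩ := hc _ rfl
    obtain ⟨h1', h2', h3'⟩ := hc' _ rfl
    simp [selectedFeature, h3, (h.lt_iff h1 h2).1 h3, h3', (h.lt_iff h1' h2').1 h3',
      h.eq_iff h1 h1']

/-- On clouds with the same order of simplices, every entry of the feature vector is the
filtration time of a fixed simplex or vanishes. -/
lemma exists_featureVector_entry (k : ℕ) (x : Cloud d r)
    (τ : Setoid (Fin (numFeatures r k)) → Equiv.Perm (Fin (numFeatures r k)))
    (q : Fin (numFeatures r k) × Fin 2) :
    (∀ y, SameOrder φ x y → featureVector 𝕂 φ k τ y q = 0) ∨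
      ∃ J : Finset (Fin r), J.Nonempty ∧
        ∀ y, SameOrder φ x y → featureVector 𝕂 φ k τ y q = φ J y := by
  obtain ⟨c, hc, hcy⟩ := exists_selection 𝕂 (φ := φ) k x (τ (birthTies 𝕂 φ k x) q.1)
  have key : ∀ y, SameOrder φ x y → featureVector 𝕂 φ k τ y q =
      if q.2 = 0 then (selectedFeature φ c y).2 else (selectedFeature φ c y).1 := by
    intro y hy
    simp only [featureVector, ← hy.birthTies_eq 𝕂 k, hcy y hy]
  rcases c with _ | ⟨I, J⟩
  · left
    intro y hy
    simp [key y hy, selectedFeature]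
  · right
    obtain ⟨h1, h2, -⟩ := hc _ rfl
    by_cases h : q.2 = 0
    · exact ⟨J, h2, fun y hy => by simp [key y hy, selectedFeature, h]⟩
    · exact ⟨I, h1, fun y hy => by simp [key y hy, selectedFeature, h]⟩

end Transfer

/-! ### Lipschitz and uniform bounds for filtration functions. -/

section Gradient

variable {d r : ℕ}

lemma isNegInvariant_volume_cloud : (volume : Measure (Cloud d r)).IsNegInvariant :=
  Measure.pi.isNegInvariant fun _ => volume

open Convolution ContinuousLinearMap in
/-- A function with an essentially bounded weak gradient has Lipschitz mollifications. -/
lemma exists_hasFDerivAt_mollification {f : Cloud d r → ℝ} {U : Set (Cloud d r)} {C : ℝ}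
    {G : Cloud d r → (Cloud d r →L[ℝ] ℝ)}
    (hG : ∀ᵐ x ∂(volume.restrict U), ‖G x‖ ≤ C) (hU : MeasurableSet U) (hC : 0 ≤ C)
    (hfG : ∀ ψ : Cloud d r → ℝ, ContDiff ℝ ((⊤ : ℕ∞) : WithTop ℕ∞) ψ → HasCompactSupport ψ →
      tsupport ψ ⊆ U → ∀ v : Cloud d r, ∫ x, f x * fderiv ℝ ψ x v = - ∫ x, G x v * ψ x)
    (b : ContDiffBump (0 : Cloud d r)) {z : Cloud d r} (hz : Metric.closedBall z b.rOut ⊆ U)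
    {g : Cloud d r → ℝ} (hg : LocallyIntegrable g volume) (hgf : Set.EqOn g f U) :
    ∃ D : Cloud d r →L[ℝ] ℝ,
      HasFDerivAt (b.normed volume ⋆[lsmul ℝ ℝ, volume] g) D z ∧ ‖D‖ ≤ C := by
  have := isNegInvariant_volume_cloud (d := d) (r := r)
  set η := b.normed (volume : Measure (Cloud d r)) with hη
  have hηc : HasCompactSupport η := b.hasCompactSupport_normed
  have hηs : ContDiff ℝ ((⊤ : ℕ∞) : WithTop ℕ∞) η := b.contDiff_normed
  have hη1 : ContDiff ℝ 1 η := hηs.of_le (by exact_mod_cast le_top)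
  have hD := hηc.hasFDerivAt_convolution_right (lsmul ℝ ℝ).flip hg hη1 z
  rw [convolution_flip] at hD
  refine ⟨_, hD, ContinuousLinearMap.opNorm_le_bound _ hC fun v => ?_⟩
  rw [convolution_precompR_apply _ hg (hηc.fderiv ℝ) (hη1.continuous_fderiv one_ne_zero),
    convolution_def]
  simp only [flip_apply, lsmul_apply, smul_eq_mul]
  -- The derivative of the mollification at `z` pairs `g` with the derivative of this reflected
  -- bump. Testing the weak gradient against it moves the derivative onto `f`, leaving an average of
  -- `G` with total weight 1.
  set ψ : Cloud d r → ℝ := fun t => η (z - t) with hψ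
  have hψd : ∀ t, fderiv ℝ ψ t v = - fderiv ℝ η (z - t) v := by
    intro t
    have h1 : HasFDerivAt ψ ((fderiv ℝ η (z - t)).comp (-ContinuousLinearMap.id ℝ (Cloud d r))) t :=
      HasFDerivAt.comp t (hη1.differentiable one_ne_zero (z - t)).hasFDerivAt
        ((hasFDerivAt_id t).const_sub z)
    rw [h1.fderiv]
    simp
  have hψs : ContDiff ℝ ((⊤ : ℕ∞) : WithTop ℕ∞) ψ := hηs.comp (contDiff_const.sub contDiff_id)
  have hsupp : ∀ t, t ∉ Metric.closedBall z b.rOut → ψ t = 0 := by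
    intro t ht
    have : z - t ∉ Function.support η := by
      rw [hη, b.support_normed_eq, Metric.mem_ball, dist_zero_right, ← dist_eq_norm, dist_comm]
      exact fun h => ht h.le
    simpa [hψ] using this
  have hts : tsupport ψ ⊆ Metric.closedBall z b.rOut :=
    closure_minimal (fun t ht => by_contra fun h => ht (hsupp t h)) Metric.isClosed_closedBall
  have hψc : HasCompactSupport ψ :=
    HasCompactSupport.of_support_subset_isCompact (isCompact_closedBall z b.rOut)
      (subset_closure.trans hts)
  have hid : ∫ t, fderiv ℝ η (z - t) v * g t = ∫ t, G t v * ψ t := by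
    have h1 := hfG ψ hψs hψc (hts.trans hz) v
    have h2 : ∫ t, f t * fderiv ℝ ψ t v = - ∫ t, fderiv ℝ η (z - t) v * g t := by
      rw [← integral_neg]
      refine integral_congr_ae (Filter.Eventually.of_forall fun t => ?_)
      by_cases ht : t ∈ U
      · simp only [hψd, hgf ht]
        ring
      · have h0 : fderiv ℝ ψ t = 0 := by
          by_contra h0
          exact ht ((hts.trans hz) (support_fderiv_subset ℝ h0))
        have h0' : fderiv ℝ η (z - t) v = 0 := by
          have := hψd t
          rw [h0] at this
          simpa using this.symm
        simp [h0, h0']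
    linarith
  rw [hid]
  have hint : ∫ t, ψ t = 1 := by
    rw [hψ, integral_sub_left_eq_self η volume z]
    exact b.integral_normed
  calc ‖∫ t, G t v * ψ t‖ ≤ ∫ t, C * ‖v‖ * ψ t := by
        refine norm_integral_le_of_norm_le
          ((hψs.continuous.integrable_of_hasCompactSupport hψc).const_mul _) ?_
        filter_upwards [(ae_restrict_iff' hU).1 hG] with t ht
        have hpos : 0 ≤ ψ t := b.nonneg_normed _
        by_cases htU : t ∈ U
        · rw [norm_mul, Real.norm_of_nonneg hpos]
          exact mul_le_mul_of_nonneg_right ((G t).le_of_opNorm_le (ht htU) v) hpos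
        · rw [hsupp t fun h => htU (hz h)]
          simp
    _ = C * ‖v‖ := by rw [integral_const_mul, hint, mul_one]

/-- A continuous function with an essentially bounded weak gradient on a convex open set is
Lipschitz there. -/
lemma HasEssBoundedGradientOn.exists_lipschitzOnWith {f : Cloud d r → ℝ} {U K : Set (Cloud d r)}
    (hf : HasEssBoundedGradientOn f U) (hU : IsOpen U) (hconv : Convex ℝ U) (hK : IsCompact K)
    (hUK : U ⊆ K) (hc : ContinuousOn f K) : ∃ C : ℝ≥0, LipschitzOnWith C f U := by
  obtain ⟨G, C₀, -, hG₀, hfG⟩ := hf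
  set C : ℝ≥0 := C₀.toNNReal
  have hG : ∀ᵐ x ∂(volume.restrict U), ‖G x‖ ≤ C := by
    filter_upwards [hG₀] with x hx using hx.trans (Real.le_coe_toNNReal _)
  -- Extension by zero makes the convolution defined everywhere; the bumps used below see only
  -- values in `U`.
  set g := K.indicator f with hgdef
  have hgf : Set.EqOn g f U := fun x hx => Set.indicator_of_mem (hUK hx) f
  have hgi : Integrable g volume :=
    (integrable_indicator_iff hK.measurableSet).2 (hc.integrableOn_compact hK)
  refine ⟨C, LipschitzOnWith.of_dist_le_mul fun x hx y hy => ?_⟩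
  have hseg : IsCompact (segment ℝ x y) := by
    rw [segment_eq_image]
    exact isCompact_Icc.image (by fun_prop)
  obtain ⟨δ, hδ, hsub⟩ := hseg.exists_cthickening_subset_open hU
    (hconv.segment_subset hx hy)
  refine le_of_forall_pos_le_add fun ε hε => ?_
  have hnear : ∀ z ∈ U, ∃ δ' > 0, ∀ w ∈ Metric.ball z δ', dist (g w) (g z) ≤ ε / 2 := by
    intro z hz
    have hcz : ContinuousAt g z :=
      ((hc.mono hUK).continuousAt (hU.mem_nhds hz)).congr
        (hgf.symm.eventuallyEq_of_mem (hU.mem_nhds hz))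
    obtain ⟨δ', h1, h2⟩ := Metric.continuousAt_iff.1 hcz (ε / 2) (half_pos hε)
    exact ⟨δ', h1, fun w hw => (h2 hw).le⟩
  obtain ⟨δx, hδx, hgx⟩ := hnear x hx
  obtain ⟨δy, hδy, hgy⟩ := hnear y hy
  set ρ := min δ (min δx δy) with hρ
  have hρ0 : 0 < ρ := lt_min hδ (lt_min hδx hδy)
  -- Only the outer radius matters: it keeps the bumps along the segment inside `U` and the
  -- mollification within `ε / 2` of `f` at both endpoints.
  let b : ContDiffBump (0 : Cloud d r) := ⟨ρ / 2, ρ, half_pos hρ0, half_lt_self hρ0⟩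
  have hbx := b.dist_normed_convolution_le (μ := volume) (x₀ := x) hgi.aestronglyMeasurable
    fun w hw => hgx w (Metric.ball_subset_ball ((min_le_right _ _).trans (min_le_left _ _)) hw)
  have hby := b.dist_normed_convolution_le (μ := volume) (x₀ := y) hgi.aestronglyMeasurable
    fun w hw => hgy w (Metric.ball_subset_ball ((min_le_right _ _).trans (min_le_right _ _)) hw)
  have hder : ∀ z ∈ segment ℝ x y, _ := fun z hz =>
    exists_hasFDerivAt_mollification hG hU.measurableSet C.2 hfG b (z := z)
      (((Metric.closedBall_subset_closedBall (min_le_left _ _)).trans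
        (Metric.closedBall_subset_cthickening hz δ)).trans hsub) hgi.locallyIntegrable hgf
  choose! D hD hDC using hder
  have hmv := (convex_segment x y).norm_image_sub_le_of_norm_hasFDerivWithin_le
    (fun z hz => (hD z hz).hasFDerivWithinAt) hDC (right_mem_segment ℝ x y)
    (left_mem_segment ℝ x y)
  rw [← dist_eq_norm, ← dist_eq_norm] at hmv
  rw [hgf hx] at hbx
  rw [hgf hy] at hby
  rw [dist_comm] at hbx
  have h4 := dist_triangle4 (f x) _ _ (f y) |>.trans (add_le_add (add_le_add hbx hmv) hby)
  linarith

lemma interior_cloudsIn (M : Set (EuclideanSpace ℝ (Fin d))) :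
    interior (cloudsIn r M) = {x | ∀ i, x i ∈ interior M} := by
  have h : cloudsIn r M = Set.univ.pi fun _ => M := by ext; simp [cloudsIn]
  rw [h, interior_pi_set Set.finite_univ]
  ext; simp

lemma isCompact_cloudsIn {M : Set (EuclideanSpace ℝ (Fin d))} (hM : IsCompact M) :
    IsCompact (cloudsIn r M) := by
  have h : cloudsIn r M = Set.univ.pi fun _ => M := by ext; simp [cloudsIn]
  rw [h]
  exact isCompact_univ_pi fun _ => hM

lemma convex_cloudsIn {M : Set (EuclideanSpace ℝ (Fin d))} (hM : Convex ℝ M) :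
    Convex ℝ (cloudsIn r M) :=
  fun _ hx _ hy _ _ ha hb hab i => hM (hx i) (hy i) ha hb hab

variable {M : Set (EuclideanSpace ℝ (Fin d))} {φ : Finset (Fin r) → Cloud d r → ℝ}

/-- Filtration functions on a convex body are jointly Lipschitz. -/
lemma IsFiltrationFunction.exists_lipschitz (hφ : IsFiltrationFunction M φ) (hM : IsCompact M)
    (hconv : Convex ℝ M) (hfull : (interior M).Nonempty) :
    ∃ C : ℝ≥0, ∀ J : Finset (Fin r), J.Nonempty → LipschitzOnWith C (φ J) (cloudsIn r M) := by
  have hK := isCompact_cloudsIn (r := r) hM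
  have hne : (interior (cloudsIn r M)).Nonempty := by
    obtain ⟨z, hz⟩ := hfull
    rw [interior_cloudsIn]
    exact ⟨fun _ => z, fun _ => hz⟩
  -- A convex body is the closure of its interior, so the Lipschitz bound extends to the boundary by
  -- continuity.
  have hcl : closure (interior (cloudsIn r M)) = cloudsIn r M := by
    rw [(convex_cloudsIn hconv).closure_interior_eq_closure_of_nonempty_interior hne,
      hK.isClosed.closure_eq]
  have h : ∀ J : Finset (Fin r), ∃ C : ℝ≥0, J.Nonempty →
      LipschitzOnWith C (φ J) (cloudsIn r M) := by
    intro J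
    by_cases hJ : J.Nonempty
    · obtain ⟨C, hC⟩ := (hφ.gradient J hJ).exists_lipschitzOnWith isOpen_interior
        (convex_cloudsIn hconv).interior hK interior_subset (hφ.continuousOn J hJ)
      refine ⟨C, fun _ => ?_⟩
      rw [← hcl]
      exact hC.closure (by rw [hcl]; exact hφ.continuousOn J hJ)
    · exact ⟨0, fun h => absurd h hJ⟩
  choose C hC using h
  exact ⟨Finset.univ.sup C, fun J hJ =>
    (hC J hJ).weaken (Finset.le_sup (Finset.mem_univ J))⟩

lemma IsFiltrationFunction.exists_bound (hφ : IsFiltrationFunction M φ) (hM : IsCompact M) :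
    ∃ B : ℝ, 0 ≤ B ∧ ∀ J : Finset (Fin r), J.Nonempty → ∀ x ∈ cloudsIn r M, |φ J x| ≤ B := by
  have hK := isCompact_cloudsIn (r := r) hM
  have h : ∀ J : Finset (Fin r), ∃ B : ℝ, J.Nonempty → ∀ x ∈ cloudsIn r M, |φ J x| ≤ B := by
    intro J
    by_cases hJ : J.Nonempty
    · obtain ⟨B, hB⟩ := hK.exists_bound_of_continuousOn (hφ.continuousOn J hJ)
      exact ⟨B, fun _ => hB⟩
    · exact ⟨0, fun h => absurd h hJ⟩
  choose B hB using h
  exact ⟨∑ J, |B J|, Finset.sum_nonneg fun _ _ => abs_nonneg _, fun J hJ x hx =>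
    ((hB J hJ x hx).trans (le_abs_self _)).trans
      (Finset.single_le_sum (f := fun J => |B J|) (fun _ _ => abs_nonneg _) (Finset.mem_univ J))⟩

end Gradient

/-! ### Norm bounds for feature vectors. -/

section FeatureVector

variable {d r : ℕ} (𝕂 : Type*) [Field 𝕂] {φ : Finset (Fin r) → Cloud d r → ℝ} {x y : Cloud d r}

lemma EuclideanSpace.norm_le_sqrt_card_mul {ι : Type*} [Fintype ι] (v : EuclideanSpace ℝ ι) {A : ℝ}
    (hA : 0 ≤ A) (h : ∀ i, |v i| ≤ A) : ‖v‖ ≤ √(Fintype.card ι) * A := by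
  rw [EuclideanSpace.norm_eq, ← Real.sqrt_sq hA, ← Real.sqrt_mul (Nat.cast_nonneg _)]
  refine Real.sqrt_le_sqrt ?_
  calc ∑ i, ‖v i‖ ^ 2 ≤ ∑ _i : ι, A ^ 2 :=
        Finset.sum_le_sum fun i _ => pow_le_pow_left₀ (norm_nonneg _) (h i) 2
    _ = Fintype.card ι * A ^ 2 := by simp

lemma norm_featureVector_le (k : ℕ)
    (τ : Setoid (Fin (numFeatures r k)) → Equiv.Perm (Fin (numFeatures r k))) {B : ℝ} (hB : 0 ≤ B)
    (h : ∀ J : Finset (Fin r), J.Nonempty → |φ J x| ≤ B) :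
    ‖featureVector 𝕂 φ k τ x‖ ≤ √(Fintype.card (Fin (numFeatures r k) × Fin 2)) * B := by
  refine EuclideanSpace.norm_le_sqrt_card_mul _ hB fun q => ?_
  rcases exists_featureVector_entry 𝕂 (φ := φ) k x τ q with h0 | ⟨J, hJ, h0⟩ <;>
    rw [h0 x fun _ _ _ _ => Iff.rfl]
  · simpa using hB
  · exact h J hJ

/-- The same tie rule must act on both clouds: with equal ties it selects the same positions, so
each entry compares one simplex with itself. -/
lemma SameOrder.norm_featureVector_sub_le (hxy : SameOrder φ x y) (k : ℕ)
    (τ : Setoid (Fin (numFeatures r k)) → Equiv.Perm (Fin (numFeatures r k))) {A : ℝ} (hA : 0 ≤ A)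
    (h : ∀ J : Finset (Fin r), J.Nonempty → |φ J x - φ J y| ≤ A) :
    ‖featureVector 𝕂 φ k τ x - featureVector 𝕂 φ k τ y‖ ≤
      √(Fintype.card (Fin (numFeatures r k) × Fin 2)) * A := by
  refine EuclideanSpace.norm_le_sqrt_card_mul _ hA fun q => ?_
  rw [PiLp.sub_apply]
  rcases exists_featureVector_entry 𝕂 (φ := φ) k x τ q with h0 | ⟨J, hJ, h0⟩ <;>
    rw [h0 x fun _ _ _ _ => Iff.rfl, h0 y hxy]
  · simpa using hA
  · exact h J hJ

/-- The order of the simplices at `x`. -/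
def orderClass (φ : Finset (Fin r) → Cloud d r → ℝ) (x : Cloud d r) (I J : Finset (Fin r)) : Prop :=
  I.Nonempty ∧ J.Nonempty ∧ φ I x ≤ φ J x

lemma sameOrder_of_orderClass_eq (h : orderClass φ x = orderClass φ y) : SameOrder φ x y := by
  intro I J hI hJ
  have := congrFun (congrFun h I) J
  simpa [orderClass, hI, hJ] using this

end FeatureVector

/-! ### Measurability of feature vectors. -/

section Measurability

lemma measurable_of_countable_pieces {Ω K β : Type*} [MeasurableSpace Ω] [MeasurableSpace β]
    [Countable K] (κ : Ω → K) (hκ : ∀ c, MeasurableSet {ω | κ ω = c}) {f : Ω → β}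
    (hf : ∀ c, ∃ h : Ω → β, Measurable h ∧ ∀ ω, κ ω = c → f ω = h ω) : Measurable f := by
  choose h hm hh using hf
  intro B hB
  have : f ⁻¹' B = ⋃ c, {ω | κ ω = c} ∩ h c ⁻¹' B := by
    ext ω
    simp only [Set.mem_preimage, Set.mem_iUnion, Set.mem_inter_iff, Set.mem_ofPred_eq]
    exact ⟨fun hω => ⟨κ ω, rfl, by rwa [← hh _ ω rfl]⟩, fun ⟨c, hc, hω⟩ => by rwa [hh c ω hc]⟩
  rw [this]
  exact MeasurableSet.iUnion fun c => (hκ c).inter (hm c hB)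

variable {d r : ℕ} (𝕂 : Type*) [Field 𝕂] {φ : Finset (Fin r) → Cloud d r → ℝ}
  {Ω : Type*} [MeasurableSpace Ω]

/-- The order of simplices together with the tie rule takes finitely many values. Where both are
fixed, each entry is a single filtration time or zero. -/
lemma measurable_featureVector (k : ℕ) {X : Ω → Cloud d r}
    (hφX : ∀ J : Finset (Fin r), J.Nonempty → Measurable fun ω => φ J (X ω))
    {τ : Ω → Setoid (Fin (numFeatures r k)) → Equiv.Perm (Fin (numFeatures r k))}
    (hτ : ∀ s σ, MeasurableSet {ω | τ ω s = σ}) :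
    Measurable fun ω => featureVector 𝕂 φ k (τ ω) (X ω) := by
  have hfin : Finite (Setoid (Fin (numFeatures r k))) :=
    Finite.of_injective (fun s => s.r) fun s t h => Setoid.ext fun a b => by
      exact iff_of_eq (congrFun (congrFun h a) b)
  have hcoord : ∀ q, Measurable fun ω => featureVector 𝕂 φ k (τ ω) (X ω) q := by
    intro q
    refine measurable_of_countable_pieces (fun ω => (orderClass φ (X ω), τ ω)) ?_ ?_
    · rintro ⟨R, σ⟩
      have h1 : MeasurableSet {ω | orderClass φ (X ω) = R} := by
        have : {ω | orderClass φ (X ω) = R} = ⋂ I, ⋂ J, {ω | orderClass φ (X ω) I J = R I J} := by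
          ext ω
          simp [funext_iff]
        rw [this]
        refine MeasurableSet.iInter fun I => MeasurableSet.iInter fun J => ?_
        have h : MeasurableSet {ω | orderClass φ (X ω) I J} := by
          by_cases hI : I.Nonempty
          · by_cases hJ : J.Nonempty
            · simpa [orderClass, hI, hJ] using measurableSet_le (hφX I hI) (hφX J hJ)
            · simp [orderClass, hJ]
          · simp [orderClass, hI]
        by_cases hR : R I J
        · simpa [hR] using h
        · convert h.compl using 1
          ext ω
          simp [hR]
      have h2 : MeasurableSet {ω | τ ω = σ} := by
        have : {ω | τ ω = σ} = ⋂ s, {ω | τ ω s = σ s} := by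
          ext ω
          simp [funext_iff]
        rw [this]
        exact MeasurableSet.iInter fun s => hτ s (σ s)
      convert h1.inter h2 using 1
      ext ω
      simp
    · rintro ⟨R, σ⟩
      by_cases hne : ∃ ω₀, orderClass φ (X ω₀) = R
      · obtain ⟨ω₀, rfl⟩ := hne
        rcases exists_featureVector_entry 𝕂 (φ := φ) k (X ω₀) σ q with h0 | ⟨J, hJ, h0⟩
        · refine ⟨fun _ => 0, measurable_const, fun ω hω => ?_⟩
          obtain ⟨h1, rfl⟩ := Prod.mk.inj hω
          exact h0 _ (sameOrder_of_orderClass_eq h1.symm)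
        · refine ⟨_, hφX J hJ, fun ω hω => ?_⟩
          obtain ⟨h1, rfl⟩ := Prod.mk.inj hω
          exact h0 _ (sameOrder_of_orderClass_eq h1.symm)
      · exact ⟨fun _ => 0, measurable_const, fun ω hω => absurd ⟨ω, (Prod.mk.inj hω).1⟩ hne⟩
  exact (WithLp.measurable_toLp 2 _).comp (measurable_pi_iff.2 hcoord)

/-- Continuity is available only on clouds in `M`, so the composition passes through the subtype. -/
lemma IsFiltrationFunction.measurable_comp {M : Set (EuclideanSpace ℝ (Fin d))}
    (hφ : IsFiltrationFunction M φ) {X : Ω → Cloud d r}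
    (hX : Measurable X) (hXM : ∀ ω, X ω ∈ cloudsIn r M) {J : Finset (Fin r)} (hJ : J.Nonempty) :
    Measurable fun ω => φ J (X ω) :=
  (hφ.continuousOn J hJ).domRestrict.measurable.comp (hX.subtype_mk (h := hXM))

end Measurability

/-! ### Law of the coupled process and the density bound. -/

section Law

variable {Ω S : Type*} [MeasurableSpace Ω] [MeasurableSpace S] {P : Measure Ω} {d r : ℕ}

/-- Replacing the innovations from lag `m` on by an independent copy does not change the joint
law. -/
lemma identDistrib_coupled_innovations {ε ε' : ℤ → Ω → S} (hε : ∀ s, Measurable (ε s))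
    (hεindep : iIndepFun ε P)
    (hcopy : IdentDistrib (fun ω s => ε' s ω) (fun ω s => ε s ω) P P)
    (hcopyindep : IndepFun (fun ω s => ε' s ω) (fun ω s => ε s ω) P) (m : ℕ) (t : ℤ) :
    IdentDistrib (fun ω (j : ℕ) => if j < m then ε (t - j) ω else ε' (t - j) ω)
      (fun ω (j : ℕ) => ε (t - j) ω) P P := by
  have hinj : Function.Injective fun j : ℕ => t - (j : ℤ) := fun i j h => by
    simp only at h
    omega
  have hind := hεindep.precomp hinj
  set V : ℕ → Ω → S := fun j ω => if j < m then ε (t - j) ω else ε' (t - j) ω with hV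
  have hV1 : ∀ j, j < m → V j = ε (t - j) := fun j hj => by ext ω; simp [hV, hj]
  have hV2 : ∀ j, ¬ j < m → V j = ε' (t - j) := fun j hj => by ext ω; simp [hV, hj]
  have hVε : ∀ j, IdentDistrib (V j) (ε (t - j)) P P := by
    intro j
    by_cases hj : j < m
    · rw [hV1 j hj]
      exact IdentDistrib.refl (hε _).aemeasurable
    · rw [hV2 j hj]
      exact hcopy.comp (measurable_pi_apply (t - (j : ℤ)))
  refine IdentDistrib.pi hVε (iIndepFun_iff_measure_inter_preimage_eq_mul.2 ?_) hind
  intro s A hA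
  -- Events are posed on the space of two-sided sequences, so that one set can be evaluated under
  -- both `ε'` and `ε`.
  have hset : ∀ T ⊆ s, MeasurableSet {f : ℤ → S | ∀ j ∈ T, f (t - j) ∈ A j} := by
    intro T hT
    have : {f : ℤ → S | ∀ j ∈ T, f (t - j) ∈ A j} = ⋂ j ∈ T, (fun f => f (t - j)) ⁻¹' A j := by
      ext f
      simp
    rw [this]
    exact Finset.measurableSet_biInter _ fun j hj => measurable_pi_apply _ (hA j (hT hj))
  have hprod : ∀ T ⊆ s, P ((fun ω s => ε s ω) ⁻¹' {f : ℤ → S | ∀ j ∈ T, f (t - j) ∈ A j}) =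
      ∏ j ∈ T, P (V j ⁻¹' A j) := by
    intro T hT
    have h1 : (fun ω s => ε s ω) ⁻¹' {f : ℤ → S | ∀ j ∈ T, f (t - j) ∈ A j} =
        ⋂ j ∈ T, ε (t - j) ⁻¹' A j := by
      ext ω
      simp
    rw [h1, hind.measure_inter_preimage_eq_mul T fun j hj => hA j (hT hj)]
    exact Finset.prod_congr rfl fun j hj => ((hVε j).measure_mem_eq (hA j (hT hj))).symm
  -- Recent lags involve only `ε` and remote lags only `ε'`. Independence of the two whole sequences
  -- separates them, and equality of laws reduces the remote part to `ε`.
  have hsplit : ⋂ j ∈ s, V j ⁻¹' A j =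
      (fun ω s => ε' s ω) ⁻¹' {f : ℤ → S | ∀ j ∈ s.filter (fun j => ¬ j < m), f (t - j) ∈ A j} ∩
      (fun ω s => ε s ω) ⁻¹' {f : ℤ → S | ∀ j ∈ s.filter (fun j => j < m), f (t - j) ∈ A j} := by
    ext ω
    simp only [Set.mem_iInter, Set.mem_preimage, Set.mem_inter_iff, Set.mem_ofPred_eq,
      Finset.mem_filter, and_imp]
    constructor
    · exact fun h => ⟨fun j hj hjm => by simpa [hV2 j hjm] using h j hj,
        fun j hj hjm => by simpa [hV1 j hjm] using h j hj⟩
    · rintro ⟨h1, h2⟩ j hj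
      by_cases hjm : j < m
      · rw [hV1 j hjm]
        exact h2 j hj hjm
      · rw [hV2 j hjm]
        exact h1 j hj hjm
  rw [hsplit, hcopyindep.measure_inter_preimage_eq_mul _ _ (hset _ (Finset.filter_subset _ _))
    (hset _ (Finset.filter_subset _ _)), hcopy.measure_mem_eq (hset _ (Finset.filter_subset _ _)),
    hprod _ (Finset.filter_subset _ _), hprod _ (Finset.filter_subset _ _), mul_comm,
    Finset.prod_filter_mul_prod_filter_not]

lemma measurable_shiftCloud {F : (ℕ → S) → Cloud d r} (hF : Measurable F) {ε : ℤ → Ω → S}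
    (hε : ∀ s, Measurable (ε s)) (t : ℤ) : Measurable (shiftCloud F ε t) :=
  hF.comp (measurable_pi_iff.2 fun j => hε (t - (j : ℤ)))

lemma measurable_coupledCloud {F : (ℕ → S) → Cloud d r} (hF : Measurable F) {ε : ℤ → Ω → S}
    {ε' : ℤ → ℤ → Ω → S} (hε : ∀ s, Measurable (ε s)) (hε' : ∀ t s, Measurable (ε' t s)) (m : ℕ)
    (t : ℤ) : Measurable (coupledCloud F ε ε' m t) := by
  refine hF.comp (measurable_pi_iff.2 fun j => ?_)
  by_cases hj : j < m
  · simpa [hj] using hε (t - (j : ℤ))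
  · simpa [hj] using hε' t (t - (j : ℤ))

lemma HasBoundedDensityOn.exists_measure_preimage_le {M : Set (EuclideanSpace ℝ (Fin d))}
    {X : Ω → Cloud d r} (h : HasBoundedDensityOn M P X) (hX : Measurable X) :
    ∃ C : ℝ≥0, ∀ A : Set (Cloud d r), MeasurableSet A → P (X ⁻¹' A) ≤ C * volume A := by
  obtain ⟨f, C, -, hfC, hmap⟩ := h
  refine ⟨C, fun A hA => ?_⟩
  rw [← Measure.map_apply hX hA, hmap, withDensity_apply _ hA]
  calc ∫⁻ a in A, f a ∂(volume.restrict (cloudsIn r M))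
      ≤ ∫⁻ _ in A, (C : ℝ≥0∞) ∂(volume.restrict (cloudsIn r M)) := lintegral_mono fun a => hfC a
    _ = C * (volume.restrict (cloudsIn r M)) A := by simp
    _ ≤ C * volume A := mul_le_mul_right (Measure.restrict_apply_le _ _) _

end Law

/-! ### The `L^p` estimate off an exceptional set. -/

section Approximation

variable {Ω : Type*} [MeasurableSpace Ω] {P : Measure Ω} {d r : ℕ}

/-- If `Z - Z'` is bounded by `L ‖X - Y‖` whenever `‖X - Y‖ ≤ t` and neither `X` nor `Y` lies in the
exceptional set `A`, and by `B` otherwise, then its `L^p` norm is bounded by the weighted norm of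
`X - Y` and the probability of the exceptional set. -/
lemma eLpNorm_le_of_exceptional_set {E : Type*} [NormedAddCommGroup E] {p : ℝ≥0∞} (hp : 1 ≤ p)
    {X Y : Ω → Cloud d r} (hX : Measurable X) (hY : Measurable Y) {A : Set (Cloud d r)}
    (hA : MeasurableSet A) {Z : Ω → E} {L B t : ℝ} (hL : 0 ≤ L) (hB : 0 ≤ B) (ht : 0 < t)
    (ht1 : t ≤ 1) (hZB : ∀ ω, ‖Z ω‖ ≤ B)
    (hZL : ∀ ω, X ω ∉ A → Y ω ∉ A → ‖X ω - Y ω‖ ≤ t → ‖Z ω‖ ≤ L * ‖X ω - Y ω‖) :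
    eLpNorm Z p P ≤ ENNReal.ofReal (L + B) * (ENNReal.ofReal t⁻¹ *
        ∑ i, eLpNorm (fun ω => X ω i - Y ω i) p P) +
      ENNReal.ofReal B * (P (X ⁻¹' A) ^ (1 / p.toReal) + P (Y ⁻¹' A) ^ (1 / p.toReal)) := by
  -- One constant serves both regimes: `L ≤ L * t⁻¹` since `t ≤ 1`, and `B ≤ B * t⁻¹ * ‖X - Y‖` once
  -- the distance exceeds `t`.
  set c : ℝ := (L + B) * t⁻¹ with hc
  have hc0 : 0 ≤ c := by positivity
  set f : Ω → ℝ := c • ∑ i, fun ω => ‖X ω i - Y ω i‖ with hf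
  set gX : Ω → ℝ := (X ⁻¹' A).indicator fun _ => B with hgX
  set gY : Ω → ℝ := (Y ⁻¹' A).indicator fun _ => B with hgY
  have hmi : ∀ i, Measurable fun ω => ‖X ω i - Y ω i‖ := fun i =>
    (((measurable_pi_apply i).comp hX).sub ((measurable_pi_apply i).comp hY)).norm
  have hfm : Measurable f := by
    have h : Measurable fun ω => c • ∑ i, ‖X ω i - Y ω i‖ :=
      (Finset.measurable_sum _ fun i _ => hmi i).const_smul c
    convert h using 1
    ext ω
    simp [hf]
  have hgXm : Measurable gX := measurable_const.indicator (hX hA)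
  have hgYm : Measurable gY := measurable_const.indicator (hY hA)
  have hgX0 : ∀ ω, 0 ≤ gX ω := fun ω => Set.indicator_nonneg (fun _ _ => hB) ω
  have hgY0 : ∀ ω, 0 ≤ gY ω := fun ω => Set.indicator_nonneg (fun _ _ => hB) ω
  have hfc : ∀ ω, c * ‖X ω - Y ω‖ ≤ f ω := by
    intro ω
    simp only [hf, Pi.smul_apply, Finset.sum_apply, smul_eq_mul]
    refine mul_le_mul_of_nonneg_left ?_ hc0
    refine (pi_norm_le_iff_of_nonneg (Finset.sum_nonneg fun _ _ => norm_nonneg _)).2 fun i => ?_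
    exact Finset.single_le_sum (f := fun i => ‖X ω i - Y ω i‖) (fun _ _ => norm_nonneg _)
      (Finset.mem_univ i)
  have hpt : ∀ ω, ‖Z ω‖ ≤ (f + (gX + gY)) ω := by
    intro ω
    have hf0 : 0 ≤ f ω := le_trans (by positivity) (hfc ω)
    simp only [Pi.add_apply]
    by_cases hXA : X ω ∈ A
    · have : gX ω = B := Set.indicator_of_mem (s := X ⁻¹' A) hXA _
      linarith [hZB ω, hgY0 ω]
    by_cases hYA : Y ω ∈ A
    · have : gY ω = B := Set.indicator_of_mem (s := Y ⁻¹' A) hYA _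
      linarith [hZB ω, hgX0 ω]
    refine le_trans ?_ ((hfc ω).trans (le_add_of_nonneg_right (add_nonneg (hgX0 ω) (hgY0 ω))))
    have hn := norm_nonneg (X ω - Y ω)
    have ht' : 1 ≤ t⁻¹ := (one_le_inv₀ ht).2 ht1
    rcases le_or_gt ‖X ω - Y ω‖ t with h | h
    · refine (hZL ω hXA hYA h).trans (mul_le_mul_of_nonneg_right ?_ hn)
      rw [hc]
      nlinarith
    · refine (hZB ω).trans ?_
      have h1 : 1 ≤ t⁻¹ * ‖X ω - Y ω‖ := by
        rw [inv_mul_eq_div, one_le_div ht]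
        exact h.le
      rw [hc, mul_assoc]
      nlinarith
  refine (eLpNorm_mono_real hpt).trans ((eLpNorm_add_le hfm.aestronglyMeasurable
    (hgXm.add hgYm).aestronglyMeasurable hp).trans (add_le_add ?_ ?_))
  · rw [hf, eLpNorm_const_smul, Real.enorm_of_nonneg hc0, hc,
      ENNReal.ofReal_mul (add_nonneg hL hB), mul_assoc]
    gcongr
    refine (eLpNorm_sum_le (fun i _ => (hmi i).aestronglyMeasurable) hp).trans
      (Finset.sum_le_sum fun i _ => ?_)
    rw [eLpNorm_norm]
  · refine (eLpNorm_add_le hgXm.aestronglyMeasurable hgYm.aestronglyMeasurable hp).trans ?_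
    rw [mul_add, ← Real.enorm_of_nonneg hB]
    exact add_le_add (eLpNorm_indicator_const_le _ _) (eLpNorm_indicator_const_le _ _)

end Approximation

/-! ### Choice of the threshold and summation. -/

theorem theorem1 {d r : ℕ} (k : ℕ) (𝕂 : Type*) [Field 𝕂]
    -- the state space and the filtration
    (M : Set (EuclideanSpace ℝ (Fin d))) (hMcompact : IsCompact M) (hMconvex : Convex ℝ M)
    (hMfull : (interior M).Nonempty)
    (φ : Finset (Fin r) → Cloud d r → ℝ) (hφ : IsFiltrationFunction M φ)
    (α : ℝ) (hα0 : 0 < α) (hα1 : α ≤ 1) (hstab : StabilityExponent M φ α)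
    -- the innovations and, for every time, an independent copy of them
    {Ω : Type*} [MeasurableSpace Ω] (P : Measure Ω) [IsProbabilityMeasure P]
    {S : Type*} [MeasurableSpace S]
    (ε : ℤ → Ω → S) (hε : ∀ s, Measurable (ε s)) (hεindep : iIndepFun ε P)
    (hεident : ∀ s, IdentDistrib (ε s) (ε 0) P P)
    (ε' : ℤ → ℤ → Ω → S) (hε' : ∀ t s, Measurable (ε' t s))
    (hcopy : ∀ t, IdentDistrib (fun ω s => ε' t s ω) (fun ω s => ε s ω) P P)
    (hcopyindep : ∀ t, IndepFun (fun ω s => ε' t s ω) (fun ω s => ε s ω) P)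
    -- the point cloud process
    (F : (ℕ → S) → Cloud d r) (hF : Measurable F) (hFM : ∀ s, F s ∈ cloudsIn r M)
    (hdens : ∀ t, HasBoundedDensityOn M P (shiftCloud F ε t))
    -- the weighted approximability condition
    (p : ℝ) (hp : 1 ≤ p) (w : ℕ → ℝ) (hw : ∀ m, w m ∈ Set.Icc (0 : ℝ) 1) (hwsum : Summable w)
    (happrox : ∀ i : Fin r,
      ∑' m : ℕ, ENNReal.ofReal (w (m + 1)) ^ (-(p / α)) *
        eLpNorm (fun ω => shiftCloud F ε 0 ω i - coupledCloud F ε ε' (m + 1) 0 ω i)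
          (ENNReal.ofReal p) P < ∞)
    -- the (possibly random) order of features with equal births
    (τ : ℤ → Ω → Setoid (Fin (numFeatures r k)) → Equiv.Perm (Fin (numFeatures r k)))
    (hτ : ∀ t ω, IsTieRule (τ t ω)) (hτmeas : ∀ t s σ, MeasurableSet {ω | τ t ω s = σ}) :
    (∀ t, MemLp (fun ω => featureVector 𝕂 φ k (τ t ω) (shiftCloud F ε t ω))
        (ENNReal.ofReal p) P) ∧
    (∀ m t, MemLp (fun ω => featureVector 𝕂 φ k (τ t ω) (coupledCloud F ε ε' m t ω))
        (ENNReal.ofReal p) P) ∧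
    ∑' m : ℕ, eLpNorm (fun ω => featureVector 𝕂 φ k (τ 0 ω) (shiftCloud F ε 0 ω)
          - featureVector 𝕂 φ k (τ 0 ω) (coupledCloud F ε ε' (m + 1) 0 ω))
        (ENNReal.ofReal p) P < ∞ := by
  have hp0 : 0 < p := lt_of_lt_of_le one_pos hp
  have hpe : 1 ≤ ENNReal.ofReal p := by simpa using ENNReal.ofReal_le_ofReal hp
  have hpt : (ENNReal.ofReal p).toReal = p := ENNReal.toReal_ofReal hp0.le
  obtain ⟨C, hC⟩ := hφ.exists_lipschitz hMcompact hMconvex hMfull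
  obtain ⟨B, hB0, hB⟩ := hφ.exists_bound hMcompact
  obtain ⟨c, hc0, hc⟩ := hstab
  have hX := measurable_shiftCloud hF hε
  have hY := measurable_coupledCloud hF hε hε'
  have hXM : ∀ t ω, shiftCloud F ε t ω ∈ cloudsIn r M := fun _ _ => hFM _
  have hYM : ∀ m t ω, coupledCloud F ε ε' m t ω ∈ cloudsIn r M := fun _ _ _ => hFM _
  have hZX : ∀ t, Measurable fun ω => featureVector 𝕂 φ k (τ t ω) (shiftCloud F ε t ω) := fun t =>
    measurable_featureVector 𝕂 k (fun J hJ => hφ.measurable_comp (hX t) (hXM t) hJ) (hτmeas t)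
  have hZY : ∀ m t, Measurable fun ω => featureVector 𝕂 φ k (τ t ω) (coupledCloud F ε ε' m t ω) :=
    fun m t => measurable_featureVector 𝕂 k
      (fun J hJ => hφ.measurable_comp (hY m t) (hYM m t) hJ) (hτmeas t)
  set κ : ℝ := √(Fintype.card (Fin (numFeatures r k) × Fin 2))
  have hZB : ∀ σ, ∀ x ∈ cloudsIn r M, ‖featureVector 𝕂 φ k σ x‖ ≤ κ * B := fun σ x hx =>
    norm_featureVector_le 𝕂 k σ hB0 fun J hJ => hB J hJ x hx
  refine ⟨fun t => MemLp.of_bound (hZX t).aestronglyMeasurable (κ * B)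
      (Filter.Eventually.of_forall fun ω => hZB _ _ (hXM t ω)),
    fun m t => MemLp.of_bound (hZY m t).aestronglyMeasurable (κ * B)
      (Filter.Eventually.of_forall fun ω => hZB _ _ (hYM m t ω)), ?_⟩
  obtain ⟨D, hD⟩ := (hdens 0).exists_measure_preimage_le (hX 0)
  have hlaw : ∀ m A, MeasurableSet A →
      P (coupledCloud F ε ε' m 0 ⁻¹' A) = P (shiftCloud F ε 0 ⁻¹' A) := fun m A hA =>
    ((identDistrib_coupled_innovations hε hεindep (hcopy 0) (hcopyindep 0) m 0).comp
      hF).measure_mem_eq hA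
  set K₁ : ℝ≥0∞ := ENNReal.ofReal (κ * C + 2 * (κ * B))
  set Q : ℝ≥0∞ := (D * ENNReal.ofReal c) ^ (1 / p)
  set K₂ : ℝ≥0∞ := ENNReal.ofReal (2 * (κ * B)) * (Q + Q)
  set δ : ℕ → Fin r → ℝ≥0∞ := fun m i =>
    eLpNorm (fun ω => shiftCloud F ε 0 ω i - coupledCloud F ε ε' (m + 1) 0 ω i)
      (ENNReal.ofReal p) P
  have hterm : ∀ m : ℕ, eLpNorm (fun ω => featureVector 𝕂 φ k (τ 0 ω) (shiftCloud F ε 0 ω)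
          - featureVector 𝕂 φ k (τ 0 ω) (coupledCloud F ε ε' (m + 1) 0 ω))
        (ENNReal.ofReal p) P ≤
      K₁ * ∑ i, ENNReal.ofReal (w (m + 1)) ^ (-(p / α)) * δ m i +
        K₂ * ENNReal.ofReal (w (m + 1)) := by
    intro m
    have hpα : 0 < p / α := div_pos hp0 hα0
    -- For weight parameter zero no positive threshold is available, but the factor is infinite:
    -- finiteness forces the two clouds to agree almost surely, and the term vanishes.
    rcases (hw (m + 1)).1.eq_or_lt with h0 | hpos
    · have hae : ∀ i, ∀ᵐ ω ∂P, shiftCloud F ε 0 ω i - coupledCloud F ε ε' (m + 1) 0 ω i = 0 := by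
        intro i
        have hfin := ENNReal.ne_top_of_tsum_ne_top (happrox i).ne m
        rw [← h0, ENNReal.ofReal_zero, ENNReal.zero_rpow_of_neg (neg_lt_zero.2 hpα)] at hfin
        have hz : δ m i = 0 := by
          by_contra hne
          exact hfin (ENNReal.top_mul hne)
        exact (eLpNorm_eq_zero_iff (((measurable_pi_apply i).comp (hX 0)).sub
          ((measurable_pi_apply i).comp (hY (m + 1) 0))).aestronglyMeasurable
          (one_pos.trans_le hpe).ne').1 hz
      have hzero : eLpNorm (fun ω => featureVector 𝕂 φ k (τ 0 ω) (shiftCloud F ε 0 ω)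
          - featureVector 𝕂 φ k (τ 0 ω) (coupledCloud F ε ε' (m + 1) 0 ω))
          (ENNReal.ofReal p) P = 0 := by
        refine (eLpNorm_eq_zero_iff ((hZX 0).sub (hZY (m + 1) 0)).aestronglyMeasurable
          (one_pos.trans_le hpe).ne').2 ?_
        filter_upwards [ae_all_iff.2 hae] with ω hω
        have : shiftCloud F ε 0 ω = coupledCloud F ε ε' (m + 1) 0 ω :=
          funext fun i => sub_eq_zero.1 (hω i)
        simp [this]
      rw [hzero]
      exact zero_le
    · set t : ℝ := w (m + 1) ^ (p / α) with ht
      have ht0 : 0 < t := Real.rpow_pos_of_pos hpos _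
      have ht1 : t ≤ 1 := Real.rpow_le_one hpos.le (hw (m + 1)).2 hpα.le
      -- The measurable hull has the same volume and spares a proof that the stability radius is
      -- measurable.
      set A := toMeasurable volume {x ∈ cloudsIn r M | stabilityRadius M φ x ≤ ENNReal.ofReal t}
      have hA : MeasurableSet A := measurableSet_toMeasurable _ _
      have hnA : ∀ x ∈ cloudsIn r M, x ∉ A → ENNReal.ofReal t < stabilityRadius M φ x :=
        fun x hx hxA => not_le.1 fun h => hxA (subset_toMeasurable _ _ ⟨hx, h⟩)
      have hPA : P (shiftCloud F ε 0 ⁻¹' A) ^ (1 / p) ≤ Q * ENNReal.ofReal (w (m + 1)) := by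
        -- This identity dictates the exponent `p / α`: the `p`-th root of the exceptional
        -- probability becomes linear in `w`.
        have htα : t ^ α = w (m + 1) ^ p := by
          rw [ht, ← Real.rpow_mul hpos.le, div_mul_cancel₀ _ hα0.ne']
        have h1 : P (shiftCloud F ε 0 ⁻¹' A) ≤
            D * ENNReal.ofReal c * ENNReal.ofReal (w (m + 1)) ^ p := by
          refine (hD A hA).trans ?_
          rw [mul_assoc, ENNReal.ofReal_rpow_of_pos hpos, ← htα, ← ENNReal.ofReal_mul hc0,
            measure_toMeasurable]
          exact mul_le_mul_right (hc t ht0.le ht1) _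
        refine (ENNReal.rpow_le_rpow h1 (by positivity)).trans (le_of_eq ?_)
        rw [ENNReal.mul_rpow_of_nonneg _ _ (by positivity), ← ENNReal.rpow_mul,
          mul_one_div_cancel hp0.ne', ENNReal.rpow_one]
      have hmain := eLpNorm_le_of_exceptional_set (P := P) hpe (hX 0) (hY (m + 1) 0) hA
        (Z := fun ω => featureVector 𝕂 φ k (τ 0 ω) (shiftCloud F ε 0 ω)
          - featureVector 𝕂 φ k (τ 0 ω) (coupledCloud F ε ε' (m + 1) 0 ω))
        (L := κ * C) (B := 2 * (κ * B)) (t := t) (by positivity) (by positivity) ht0 ht1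
        (fun ω => by
          have h1 := hZB (τ 0 ω) _ (hXM 0 ω)
          have h2 := hZB (τ 0 ω) _ (hYM (m + 1) 0 ω)
          exact (norm_sub_le _ _).trans (by linarith))
        (fun ω hXA hYA hle => by
          rw [mul_assoc]
          refine (sameOrder_of_dist_le hφ (hXM 0 ω) (hYM (m + 1) 0 ω) (hnA _ (hXM 0 ω) hXA)
            (hnA _ (hYM (m + 1) 0 ω) hYA) hle).norm_featureVector_sub_le 𝕂 k _ (by positivity)
            fun J hJ => ?_
          have := (hC J hJ).dist_le_mul _ (hXM 0 ω) _ (hYM (m + 1) 0 ω)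
          rwa [dist_eq_norm, dist_eq_norm, Real.norm_eq_abs] at this)
      refine hmain.trans (add_le_add ?_ ?_)
      · rw [ENNReal.ofReal_rpow_of_pos hpos, Real.rpow_neg hpos.le, Finset.mul_sum]
      · rw [hpt, hlaw _ _ hA, mul_assoc, add_mul]
        exact mul_le_mul_right (add_le_add hPA hPA) _
  refine (ENNReal.tsum_le_tsum hterm).trans_lt ?_
  rw [ENNReal.tsum_add, ENNReal.tsum_mul_left, ENNReal.tsum_mul_left,
    Summable.tsum_finsetSum fun _ _ => ENNReal.summable]
  have hQ : Q ≠ ⊤ := ENNReal.rpow_ne_top_of_nonneg (by positivity)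
    (ENNReal.mul_ne_top ENNReal.coe_ne_top ENNReal.ofReal_ne_top)
  refine ENNReal.add_lt_top.2 ⟨ENNReal.mul_lt_top ENNReal.ofReal_lt_top
    (ENNReal.sum_lt_top.2 fun i _ => happrox i), ENNReal.mul_lt_top
    (ENNReal.mul_lt_top ENNReal.ofReal_lt_top
      (ENNReal.add_lt_top.2 ⟨hQ.lt_top, hQ.lt_top⟩))
    (Summable.tsum_ofReal_lt_top ((summable_nat_add_iff 1).2 hwsum))⟩
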